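/- Let $p\ge 1$ and let $\Psi,\Gamma$ be fixed real symmetric positive definite $p\times p$ matrices. (By rescaling $\Sigma\mapsto C\Sigma C^\top$ one may assume $\Psi/2=I$ and $\Gamma/2=\mathrm{diag}(\gamma_1,\dots,\gamma_p)$ with all $\gamma_i>0$.) For real $\lambda>-1$ let $\mathrm{MGIG}_p(\lambda,\Psi,\Gamma)$ be the distribution on positive definite matrices whose density with respect to Lebesgue measure $d\Sigma=\prod_{i\le j}d\sigma_{ij}$ is proportional to $|\Sigma|^{\lambda}\exp\{-\mathrm{tr}(\Psi\Sigma+\Gamma\Sigma^{-1})/2\}$, and let $W_p(2\lambda+p+1,\Psi^{-1})$ be the Wishart distribution, with density proportional to $|\Sigma|^{\lambda}\exp\{-\mathrm{tr}(\Psi\Sigma)/2\}$. Consider the independent Metropolis--Hastings sampler with target $\mathrm{MGIG}_p(\lambda,\Psi,\Gamma)$ and proposal $W_p(2\lambda+p+1,\Psi^{-1})$, and let $\Sigma_{\rm old}\sim \mathrm{MGIG}_p(\lambda,\Psi,\Gamma)$ and $\Sigma_{\rm new}\sim W_p(2\lambda+p+1,\Psi^{-1})$ be independent. Then the average acceptance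 rate $$\mathrm{AAR}(\lambda,\Psi,\Gamma)=2\,\mathbb P\big[\mathrm{tr}(\Gamma\Sigma_{\rm new}^{-1})\le \mathrm{tr}(\Gamma\Sigma_{\rm old}^{-1})\big]$$ tends to $1$ as $\lambda\to\infty$, and so does the expected Metropolis--Hastings acceptance probability $$\mathbb E\Big[\min\Big\{1,\ \frac{\pi(\Sigma_{\rm new})\,q(\Sigma_{\rm old})}{\pi(\Sigma_{\rm old})\,q(\Sigma_{\rm new})}\Big\}\Big],$$ where $\pi$ and $q$ are the densities of the target and of the proposal. -/

import Mathlib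

open MeasureTheory Filter Topology

noncomputable section

/-- Index set of the free entries `σ_{ij}`, `i ≤ j`, of a symmetric `p × p` matrix. -/
abbrev UpperIndex (p : ℕ) : Type := {q : Fin p × Fin p // q.1 ≤ q.2}

/-- The symmetric matrix with prescribed entries on and above the diagonal. -/
def symMatrix {p : ℕ} (x : UpperIndex p → ℝ) : Matrix (Fin p) (Fin p) ℝ :=
  Matrix.of fun i j => x ⟨(min i j, max i j), min_le_max⟩

/-- The (Borel) product sigma-algebra on matrices, generated by the entries. -/
instance matrixMeasurableSpace {p : ℕ} : MeasurableSpace (Matrix (Fin p) (Fin p) ℝ) :=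
  inferInstanceAs (MeasurableSpace (Fin p → Fin p → ℝ))

/-- Lebesgue measure `dS = ∏_{i ≤ j} dS_{ij}` on the symmetric matrices, as a measure on all
`p × p` matrices that is carried by the symmetric ones. -/
def symLebesgue (p : ℕ) : Measure (Matrix (Fin p) (Fin p) ℝ) :=
  (volume : Measure (UpperIndex p → ℝ)).map symMatrix

open Classical in
/-- Unnormalized density `|S|^l exp{- tr(Ψ S + Γ S⁻¹) / 2}` of the matrix generalized inverse
Gaussian distribution, on positive definite `S`. -/
def mgigKernel {p : ℕ} (l : ℝ) (Ψ Γ S : Matrix (Fin p) (Fin p) ℝ) : ℝ :=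
  if S.PosDef then S.det ^ l * Real.exp (-(Ψ * S + Γ * S⁻¹).trace / 2) else 0

/-- Density of `MGIG_p(l, Ψ, Γ)` with respect to `symLebesgue p`. -/
def mgigDensity {p : ℕ} (l : ℝ) (Ψ Γ S : Matrix (Fin p) (Fin p) ℝ) : ℝ :=
  mgigKernel l Ψ Γ S / ∫ T, mgigKernel l Ψ Γ T ∂(symLebesgue p)

/-- The distribution `MGIG_p(l, Ψ, Γ)`. -/
def mgig {p : ℕ} (l : ℝ) (Ψ Γ : Matrix (Fin p) (Fin p) ℝ) :
    Measure (Matrix (Fin p) (Fin p) ℝ) :=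
  (symLebesgue p).withDensity fun S => ENNReal.ofReal (mgigDensity l Ψ Γ S)

open Classical in
/-- Unnormalized density `|S|^{ν/2 - (p+1)/2} exp{- tr(S P⁻¹) / 2}` of the Wishart distribution,
on positive definite `S`. -/
def wishartKernel {p : ℕ} (ν : ℝ) (P S : Matrix (Fin p) (Fin p) ℝ) : ℝ :=
  if S.PosDef then
    S.det ^ (ν / 2 - ((p : ℝ) + 1) / 2) * Real.exp (-(S * P⁻¹).trace / 2)
  else 0

/-- Density of the Wishart distribution `W_p(ν, P)` with respect to `symLebesgue p`. -/
def wishartDensity {p : ℕ} (ν : ℝ) (P S : Matrix (Fin p) (Fin p) ℝ) : ℝ :=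
  wishartKernel ν P S / ∫ T, wishartKernel ν P T ∂(symLebesgue p)

/-- The Wishart distribution `W_p(ν, P)`. -/
def wishart {p : ℕ} (ν : ℝ) (P : Matrix (Fin p) (Fin p) ℝ) :
    Measure (Matrix (Fin p) (Fin p) ℝ) :=
  (symLebesgue p).withDensity fun S => ENNReal.ofReal (wishartDensity ν P S)

/-- Density of the Wishart proposal `W_p(2 l + p + 1, Ψ⁻¹)` of the independent
Metropolis-Hastings sampler for `MGIG_p(l, Ψ, Γ)`. -/
def proposalDensity {p : ℕ} (l : ℝ) (Ψ S : Matrix (Fin p) (Fin p) ℝ) : ℝ :=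
  wishartDensity (2 * l + ((p : ℝ) + 1)) Ψ⁻¹ S

/-- The Wishart proposal distribution `W_p(2 l + p + 1, Ψ⁻¹)`. -/
def proposal {p : ℕ} (l : ℝ) (Ψ : Matrix (Fin p) (Fin p) ℝ) :
    Measure (Matrix (Fin p) (Fin p) ℝ) :=
  wishart (2 * l + ((p : ℝ) + 1)) Ψ⁻¹

/-- Metropolis-Hastings probability of accepting the proposed `Snew` at the current state `Sold`. -/
def acceptanceProb {p : ℕ} (l : ℝ) (Ψ Γ Sold Snew : Matrix (Fin p) (Fin p) ℝ) : ℝ :=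
  min 1 ((mgigDensity l Ψ Γ Snew * proposalDensity l Ψ Sold) /
    (mgigDensity l Ψ Γ Sold * proposalDensity l Ψ Snew))

/-- Joint law of the independent pair `(Sold, Snew)`: the current state follows the target
`MGIG_p(l, Ψ, Γ)` and the proposed state follows the Wishart proposal. -/
def oldNewLaw {p : ℕ} (l : ℝ) (Ψ Γ : Matrix (Fin p) (Fin p) ℝ) :
    Measure (Matrix (Fin p) (Fin p) ℝ × Matrix (Fin p) (Fin p) ℝ) :=
  (mgig l Ψ Γ).prod (proposal l Ψ)

/-- The average acceptance rate `2 ℙ[tr(Γ Snew⁻¹) ≤ tr(Γ Sold⁻¹)]`. -/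
def averageAcceptanceRate {p : ℕ} (l : ℝ) (Ψ Γ : Matrix (Fin p) (Fin p) ℝ) : ℝ :=
  2 * (oldNewLaw l Ψ Γ).real {z | (Γ * z.2⁻¹).trace ≤ (Γ * z.1⁻¹).trace}

/-- The average acceptance rate as an expectation: the mean of the Metropolis-Hastings acceptance
probability of the sampler at stationarity. -/
def expectedAcceptanceProb {p : ℕ} (l : ℝ) (Ψ Γ : Matrix (Fin p) (Fin p) ℝ) : ℝ :=
  ∫ z, acceptanceProb l Ψ Γ z.1 z.2 ∂(oldNewLaw l Ψ Γ)

end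

/-! Write `Y(S) = tr(Γ S⁻¹)`, which is nonnegative on the cone. The target has density `exp(-Y/2) /
R` with respect to the proposal, where `R ≤ 1` is the proposal mean of `exp(-Y/2)`
(`normalizationRatio`). Both acceptance rates are controlled by `R` alone, so it suffices that `R →
1`.

For this, shift `S` to `S + Γ`. Since `det (S + Γ) ≥ det S * (1 + Y)`, Bernoulli's inequality gives
`det (S + Γ) ^ l ≥ det S ^ l * (1 + l Y)`, and translation invariance of Lebesgue measure bounds the
proposal mean of `1 + l Y` by `exp(tr(Ψ Γ)/2)`. Hence `Y` has mean `O(1/l)`, and `exp(-Y/2) ≥ 1 -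
Y/2` yields `R ≥ 1 - O(1/l)` (`mgigKernel_shift_le`, `integral_mgigKernel_zero_mul_le`).

The acceptance probability is at least `exp(-Y(Snew)/2)`, whose mean is `R`. For the comparison
probability, the target is at most `R⁻¹` times the proposal, and two independent proposal draws
compare with probability exactly 1/2 because `Y` has no atoms (`symLebesgue_level_set_eq_zero`). -/

/-- A real positive semidefinite matrix has a square factorization `A = Cᵀ C`. -/
theorem Matrix.PosSemidef.exists_eq_conjTranspose_mul_self {n : Type*} [Fintype n] [DecidableEq n]
    {A : Matrix n n ℝ} (hA : A.PosSemidef) : ∃ C : Matrix n n ℝ, A = C.conjTranspose * C := by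
  open scoped MatrixOrder Matrix.Norms.L2Operator in
  exact CStarAlgebra.nonneg_iff_eq_star_mul_self.mp hA.nonneg

/-! ### Trace and determinant inequalities for positive semidefinite matrices. -/

theorem Matrix.PosSemidef.trace_mul_nonneg {n : Type*} [Fintype n] [DecidableEq n]
    {A B : Matrix n n ℝ} (hA : A.PosSemidef) (hB : B.PosSemidef) : 0 ≤ (A * B).trace := by
  obtain ⟨C, rfl⟩ := hB.exists_eq_conjTranspose_mul_self
  rw [← Matrix.mul_assoc, Matrix.trace_mul_comm, ← Matrix.mul_assoc]
  exact (hA.mul_mul_conjTranspose_same C).trace_nonneg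

/-- For a Gram matrix this is `|ab| ≤ (a² + b²)/2` applied row by row to the factor `C`. It lets the
trace control both the determinant and the norm of the entries. -/
theorem Matrix.PosSemidef.abs_apply_le_trace {n : Type*} [Fintype n] [DecidableEq n]
    {A : Matrix n n ℝ} (hA : A.PosSemidef) (i j : n) : |A i j| ≤ A.trace := by
  obtain ⟨C, rfl⟩ := hA.exists_eq_conjTranspose_mul_self
  have htr : (C.conjTranspose * C).trace = ∑ k, ∑ m, C k m ^ 2 := by
    rw [Matrix.trace, Finset.sum_comm]
    simp [Matrix.mul_apply, pow_two]
  rw [htr, Matrix.mul_apply]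
  refine (Finset.abs_sum_le_sum_abs _ _).trans (Finset.sum_le_sum fun k _ => ?_)
  have h : ∀ m, C k m ^ 2 ≤ ∑ m, C k m ^ 2 := fun m =>
    Finset.single_le_sum (f := fun m => C k m ^ 2) (fun m _ => sq_nonneg _) (Finset.mem_univ m)
  have hi := h i
  have hj := h j
  simp only [Matrix.conjTranspose_apply, star_trivial]
  rw [abs_le]
  constructor <;> nlinarith [sq_nonneg (C k i - C k j), sq_nonneg (C k i + C k j)]

theorem one_add_sum_le_prod_one_add {ι : Type*} (s : Finset ι) {f : ι → ℝ} (hf : ∀ i, 0 ≤ f i) :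
    1 + ∑ i ∈ s, f i ≤ ∏ i ∈ s, (1 + f i) := by
  classical
  induction s using Finset.induction_on with
  | empty => simp
  | insert a s ha ih =>
    rw [Finset.sum_insert ha, Finset.prod_insert ha]
    have h1 : 0 ≤ ∑ i ∈ s, f i := Finset.sum_nonneg fun i _ => hf i
    nlinarith [hf a, mul_nonneg (hf a) h1, mul_le_mul_of_nonneg_left ih (add_nonneg zero_le_one (hf a))]

/-- In an eigenbasis this compares `∏ (1 + λᵢ)` with the first two terms of its expansion. -/
theorem Matrix.PosSemidef.one_add_trace_le_det_one_add {n : Type*} [Fintype n] [DecidableEq n]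
    {A : Matrix n n ℝ} (hA : A.PosSemidef) : 1 + A.trace ≤ (1 + A).det := by
  have hdet : (1 + A).det = ∏ i, (1 + hA.1.eigenvalues i) := by
    have h1 : (1 + A) = Unitary.conjStarAlgAut ℝ _ hA.1.eigenvectorUnitary
        (1 + Matrix.diagonal (hA.1.eigenvalues)) := by
      rw [map_add, map_one]
      congr 1
      exact hA.1.spectral_theorem
    rw [h1, Unitary.conjStarAlgAut_apply, Matrix.det_mul, mul_comm, ← Matrix.det_mul,
      ← Matrix.mul_assoc, Unitary.coe_star_mul_self, one_mul, ← Matrix.diagonal_one,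
      Matrix.diagonal_add, Matrix.det_diagonal]
  rw [hdet, hA.1.trace_eq_sum_eigenvalues]
  exact one_add_sum_le_prod_one_add _ hA.eigenvalues_nonneg

/-- Factor `S + G = (1 + G S⁻¹) S` and write `S⁻¹ = Cᵀ C`. Sylvester's identity replaces `G S⁻¹`,
which need not be symmetric, by the positive semidefinite `C G Cᵀ`. -/
theorem Matrix.PosDef.det_mul_one_add_trace_le {n : Type*} [Fintype n] [DecidableEq n]
    {S G : Matrix n n ℝ} (hS : S.PosDef) (hG : G.PosSemidef) :
    S.det * (1 + (G * S⁻¹).trace) ≤ (S + G).det := by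
  obtain ⟨C, hC⟩ := hS.inv.posSemidef.exists_eq_conjTranspose_mul_self
  have hfac : S + G = (1 + G * S⁻¹) * S := by
    rw [Matrix.add_mul, one_mul, Matrix.mul_assoc,
      Matrix.nonsing_inv_mul _ hS.det_pos.ne'.isUnit, Matrix.mul_one]
  have hdet : (1 + G * S⁻¹).det = (1 + C * G * C.conjTranspose).det := by
    rw [hC, ← Matrix.mul_assoc, Matrix.det_one_add_mul_comm, ← Matrix.mul_assoc]
  have htr : (G * S⁻¹).trace = (C * G * C.conjTranspose).trace := by
    rw [hC, ← Matrix.mul_assoc, Matrix.trace_mul_comm, ← Matrix.mul_assoc]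
  rw [hfac, Matrix.det_mul, hdet, htr, mul_comm]
  exact mul_le_mul_of_nonneg_right
    (hG.mul_mul_conjTranspose_same C).one_add_trace_le_det_one_add hS.det_pos.le

theorem Matrix.IsHermitian.sub_smul_one_eq {n : Type*} [Fintype n] [DecidableEq n]
    {A : Matrix n n ℝ} (hA : A.IsHermitian) (c : ℝ) :
    A - c • (1 : Matrix n n ℝ) = (hA.eigenvectorUnitary : Matrix n n ℝ) *
      Matrix.diagonal (fun i => hA.eigenvalues i - c) *
        star (hA.eigenvectorUnitary : Matrix n n ℝ) := by
  have h1 : A - c • (1 : Matrix n n ℝ) = Unitary.conjStarAlgAut ℝ _ hA.eigenvectorUnitary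
      (Matrix.diagonal (hA.eigenvalues) - c • (1 : Matrix n n ℝ)) := by
    rw [map_sub, map_smul, map_one]
    congr 1
    exact hA.spectral_theorem
  rw [h1, Unitary.conjStarAlgAut_apply, Matrix.smul_one_eq_diagonal, Matrix.diagonal_sub]

theorem Matrix.IsHermitian.posSemidef_sub_smul_one {n : Type*} [Fintype n] [DecidableEq n]
    {A : Matrix n n ℝ} (hA : A.IsHermitian) {c : ℝ} (hc : ∀ i, c ≤ hA.eigenvalues i) :
    (A - c • (1 : Matrix n n ℝ)).PosSemidef := by
  rw [hA.sub_smul_one_eq c, Matrix.star_eq_conjTranspose]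
  exact (Matrix.PosSemidef.diagonal fun i => sub_nonneg.mpr (hc i)).mul_mul_conjTranspose_same _

theorem Matrix.PosDef.exists_pos_smul_one_le {n : Type*} [Fintype n] [DecidableEq n]
    {A : Matrix n n ℝ} (hA : A.PosDef) :
    ∃ c : ℝ, 0 < c ∧ (A - c • (1 : Matrix n n ℝ)).PosSemidef := by
  obtain ⟨c, hc, h⟩ : ∃ c : ℝ, 0 < c ∧ ∀ i, c ≤ hA.1.eigenvalues i := by
    cases isEmpty_or_nonempty n
    · exact ⟨1, one_pos, fun i => isEmptyElim i⟩
    · obtain ⟨i, hi⟩ := Finite.exists_min hA.1.eigenvalues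
      exact ⟨_, hA.eigenvalues_pos i, hi⟩
  exact ⟨c, hc, hA.1.posSemidef_sub_smul_one h⟩

theorem Matrix.PosDef.exists_mul_trace_le {n : Type*} [Fintype n] [DecidableEq n]
    {A : Matrix n n ℝ} (hA : A.PosDef) :
    ∃ c : ℝ, 0 < c ∧ ∀ S : Matrix n n ℝ, S.PosSemidef → c * S.trace ≤ (A * S).trace := by
  obtain ⟨c, hc, h⟩ := hA.exists_pos_smul_one_le
  refine ⟨c, hc, fun S hS => ?_⟩
  have := h.trace_mul_nonneg hS
  rw [Matrix.sub_mul, Matrix.trace_sub, Matrix.smul_mul, Matrix.one_mul, Matrix.trace_smul,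
    smul_eq_mul] at this
  linarith

theorem Matrix.IsHermitian.exists_nat_posDef_add_smul_one {n : Type*} [Fintype n] [DecidableEq n]
    {A : Matrix n n ℝ} (hA : A.IsHermitian) :
    ∃ m : ℕ, (A + (m : ℝ) • (1 : Matrix n n ℝ)).PosDef := by
  obtain ⟨c, hc⟩ : ∃ c : ℝ, ∀ i, c ≤ hA.eigenvalues i := by
    cases isEmpty_or_nonempty n
    · exact ⟨1, fun i => isEmptyElim i⟩
    · obtain ⟨i, hi⟩ := Finite.exists_min hA.eigenvalues
      exact ⟨_, hi⟩
  obtain ⟨m, hm⟩ := exists_nat_gt (-c)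
  refine ⟨m, ?_⟩
  have h : A + (m : ℝ) • (1 : Matrix n n ℝ) =
      (A - c • (1 : Matrix n n ℝ)) + (c + m) • (1 : Matrix n n ℝ) := by
    rw [add_smul]; abel
  rw [h]
  exact Matrix.PosDef.posSemidef_add (hA.posSemidef_sub_smul_one hc)
    (Matrix.PosDef.one.smul (by linarith))

/-! ### Measurability of the cone and of the kernels. -/

section Measurability

variable {p : ℕ}

instance matrixBorelSpace : BorelSpace (Matrix (Fin p) (Fin p) ℝ) :=
  inferInstanceAs (BorelSpace (Fin p → Fin p → ℝ))

theorem continuous_symMatrix : Continuous (symMatrix (p := p)) :=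
  continuous_matrix fun _ _ => continuous_apply _

theorem measurable_symMatrix : Measurable (symMatrix (p := p)) :=
  continuous_symMatrix.measurable

theorem measurable_matrix_det : Measurable fun S : Matrix (Fin p) (Fin p) ℝ => S.det :=
  (continuous_id.matrix_det).measurable

theorem measurable_trace_mul_inv (G : Matrix (Fin p) (Fin p) ℝ) :
    Measurable fun S : Matrix (Fin p) (Fin p) ℝ => (G * S⁻¹).trace := by
  have h : (fun S : Matrix (Fin p) (Fin p) ℝ => (G * S⁻¹).trace) =
      fun S => S.det⁻¹ * (G * S.adjugate).trace := by
    funext S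
    rw [Matrix.inv_def, Ring.inverse_eq_inv', Matrix.mul_smul, Matrix.trace_smul, smul_eq_mul]
  -- Cramer's rule leaves only polynomials in the entries and one scalar inverse.
  rw [h]
  exact measurable_matrix_det.inv.mul
    ((continuous_const.matrix_mul continuous_id.matrix_adjugate).matrix_trace).measurable

theorem measurableSet_posDef : MeasurableSet {S : Matrix (Fin p) (Fin p) ℝ | S.PosDef} := by
  have h : {S : Matrix (Fin p) (Fin p) ℝ | S.PosDef} =
      {S | S.conjTranspose = S} ∩ (⋂ x : Fin p → ℝ, {S | 0 ≤ star x ⬝ᵥ (S.mulVec x)}) ∩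
        {S | S.det ≠ 0} := by
    ext S
    simp only [Set.mem_ofPred_eq, Set.mem_inter_iff, Set.mem_iInter]
    constructor
    · exact fun hS => ⟨⟨hS.1, hS.posSemidef.dotProduct_mulVec_nonneg⟩, hS.det_pos.ne'⟩
    · exact fun hS => (Matrix.PosSemidef.of_dotProduct_mulVec_nonneg hS.1.1
        hS.1.2).posDef_iff_det_ne_zero.2 hS.2
  rw [h]
  refine (IsClosed.measurableSet (IsClosed.inter ?_ (isClosed_iInter fun x => ?_))).inter ?_
  · exact isClosed_eq continuous_id.matrix_conjTranspose continuous_id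
  · exact isClosed_le continuous_const
      (continuous_const.dotProduct (continuous_id.matrix_mulVec continuous_const))
  · exact measurable_matrix_det (measurableSet_singleton 0).compl

theorem measurable_mgigKernel (l : ℝ) (P G : Matrix (Fin p) (Fin p) ℝ) :
    Measurable (mgigKernel l P G) := by
  classical
  have h : Measurable fun S : Matrix (Fin p) (Fin p) ℝ => (P * S + G * S⁻¹).trace := by
    simp only [Matrix.trace_add]
    exact ((continuous_const.matrix_mul continuous_id).matrix_trace).measurable.add
      (measurable_trace_mul_inv G)
  exact Measurable.ite measurableSet_posDef
    ((measurable_matrix_det.pow_const l).mul (h.neg.div_const 2).exp) measurable_const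

end Measurability

/-! ### Translation, scaling and null sets of Lebesgue measure on symmetric matrices. -/

section SymLebesgue

variable {p : ℕ}

instance symLebesgue_sFinite : SFinite (symLebesgue p) :=
  inferInstanceAs (SFinite (Measure.map _ _))

theorem symLebesgue_apply {s : Set (Matrix (Fin p) (Fin p) ℝ)} (hs : MeasurableSet s) :
    symLebesgue p s = volume (symMatrix ⁻¹' s) :=
  Measure.map_apply measurable_symMatrix hs

theorem symMatrix_add (x y : UpperIndex p → ℝ) :
    symMatrix (x + y) = symMatrix x + symMatrix y := rfl

theorem symMatrix_isHermitian (x : UpperIndex p → ℝ) : (symMatrix x).IsHermitian := by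
  ext i j
  simp [symMatrix, min_comm, max_comm]

theorem symMatrix_apply_of_isHermitian {G : Matrix (Fin p) (Fin p) ℝ} (hG : G.IsHermitian) :
    symMatrix (fun q => G q.1.1 q.1.2) = G := by
  ext i j
  rcases le_total i j with h | h
  · simp [symMatrix, h]
  · simpa [symMatrix, h] using hG.apply i j

theorem measurePreserving_add_symLebesgue {G : Matrix (Fin p) (Fin p) ℝ} (hG : G.IsHermitian) :
    MeasurePreserving (fun S => S + G) (symLebesgue p) (symLebesgue p) := by
  have hm : Measurable fun S : Matrix (Fin p) (Fin p) ℝ => S + G :=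
    (continuous_id.add continuous_const).measurable
  refine ⟨hm, ?_⟩
  rw [symLebesgue, Measure.map_map hm measurable_symMatrix]
  have h : (fun S => S + G) ∘ symMatrix =
      symMatrix ∘ fun x : UpperIndex p → ℝ => x + fun q => G q.1.1 q.1.2 := by
    funext x
    rw [Function.comp_apply, Function.comp_apply, symMatrix_add,
      symMatrix_apply_of_isHermitian hG]
  rw [h, ← Measure.map_map measurable_symMatrix (measurable_add_const _),
    map_add_right_eq_self]

theorem symLebesgue_smul_preimage {s : Set (Matrix (Fin p) (Fin p) ℝ)} (hs : MeasurableSet s)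
    {t : ℝ} (ht : t ≠ 0) :
    symLebesgue p ((fun S => t • S) ⁻¹' s) =
      ENNReal.ofReal |(t ^ Module.finrank ℝ (UpperIndex p → ℝ))⁻¹| * symLebesgue p s := by
  have hm : Measurable fun S : Matrix (Fin p) (Fin p) ℝ => t • S :=
    (continuous_id.const_smul t).measurable
  rw [symLebesgue_apply hs, symLebesgue_apply (hm hs),
    ← Measure.addHaar_preimage_smul volume ht]
  rfl

/-- The translates of the cone by `-m • 1`, for natural `m`, cover all symmetric matrices and have
equal measure; a null cone would make the whole space null. -/
theorem symLebesgue_posDef_ne_zero :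
    symLebesgue p {S : Matrix (Fin p) (Fin p) ℝ | S.PosDef} ≠ 0 := by
  intro h0
  have hpre : ∀ m : ℕ, symLebesgue p
      ((fun S => S + (m : ℝ) • (1 : Matrix (Fin p) (Fin p) ℝ)) ⁻¹' {S | S.PosDef}) = 0 := by
    intro m
    have hH : ((m : ℝ) • (1 : Matrix (Fin p) (Fin p) ℝ)).IsHermitian :=
      (Matrix.PosSemidef.one.smul m.cast_nonneg).1
    rw [(measurePreserving_add_symLebesgue hH).measure_preimage
      measurableSet_posDef.nullMeasurableSet, h0]
  have hU := measure_iUnion_null hpre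
  have hmeas : ∀ m : ℕ, MeasurableSet
      ((fun S => S + (m : ℝ) • (1 : Matrix (Fin p) (Fin p) ℝ)) ⁻¹' {S | S.PosDef}) := fun m =>
    Continuous.measurable (by fun_prop) measurableSet_posDef
  rw [symLebesgue_apply (MeasurableSet.iUnion hmeas)] at hU
  have huniv : symMatrix ⁻¹' (⋃ m : ℕ,
      (fun S => S + (m : ℝ) • (1 : Matrix (Fin p) (Fin p) ℝ)) ⁻¹' {S | S.PosDef}) =
        Set.univ := by
    refine Set.eq_univ_of_forall fun x => ?_
    simp only [Set.mem_preimage, Set.mem_iUnion]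
    exact (symMatrix_isHermitian x).exists_nat_posDef_add_smul_one
  rw [huniv, Measure.measure_univ_eq_zero] at hU
  exact NeZero.ne _ hU

/-- The level sets of `S ↦ tr(G S⁻¹)` on the positive definite cone are Lebesgue null, because
scaling permutes them and only countably many of them can have positive measure. -/
theorem symLebesgue_level_set_eq_zero (hp : 1 ≤ p) {G : Matrix (Fin p) (Fin p) ℝ}
    (hG : G.PosDef) (c : ℝ) :
    symLebesgue p {S | S.PosDef ∧ (G * S⁻¹).trace = c} = 0 := by
  classical
  have : Nonempty (Fin p) := ⟨⟨0, hp⟩⟩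
  have hmeas : ∀ d : ℝ, MeasurableSet {S : Matrix (Fin p) (Fin p) ℝ |
      S.PosDef ∧ (G * S⁻¹).trace = d} := fun d =>
    measurableSet_posDef.inter (measurable_trace_mul_inv G (measurableSet_singleton d))
  have hpos : ∀ S : Matrix (Fin p) (Fin p) ℝ, S.PosDef → 0 < (G * S⁻¹).trace := by
    intro S hS
    obtain ⟨a, ha, h⟩ := hG.exists_mul_trace_le
    exact (mul_pos ha hS.inv.trace_pos).trans_le (h _ hS.inv.posSemidef)
  by_contra hne
  have hc : 0 < c := by
    obtain ⟨S, hS, rfl⟩ := nonempty_of_measure_ne_zero hne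
    exact hpos S hS
  -- Since `Y(t S) = Y(S) / t`, scaling by `d / c` relates the levels `c` and `d`, so one non-null
  -- level makes every positive level non-null. The `if` only extends `Y` measurably off the cone.
  have hall : ∀ d ∈ Set.Ioi (0 : ℝ), 0 < symLebesgue p
      {S | (if S.PosDef then (G * S⁻¹).trace else 0) = d} := by
    intro d hd
    have hd : 0 < d := hd
    have ht : 0 < d / c := div_pos hd hc
    have hsub : (fun S => (d / c) • S) ⁻¹' {S : Matrix (Fin p) (Fin p) ℝ |
        S.PosDef ∧ (G * S⁻¹).trace = c} ⊆
          {S | (if S.PosDef then (G * S⁻¹).trace else 0) = d} := by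
      rintro S ⟨hS, hY⟩
      have hS' : S.PosDef := by
        have := hS.smul (inv_pos.2 ht)
        rwa [smul_smul, inv_mul_cancel₀ ht.ne', one_smul] at this
      have hinv : ((d / c) • S)⁻¹ = (d / c)⁻¹ • S⁻¹ :=
        Matrix.inv_smul' _ (Units.mk0 _ ht.ne') hS'.det_pos.ne'.isUnit
      rw [hinv, Matrix.mul_smul, Matrix.trace_smul, smul_eq_mul] at hY
      simp only [Set.mem_ofPred_eq, if_pos hS']
      field_simp at hY
      linarith
    refine lt_of_lt_of_le ?_ (measure_mono hsub)
    rw [symLebesgue_smul_preimage (hmeas c) ht.ne']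
    exact ENNReal.mul_pos (ENNReal.ofReal_pos.2 (by positivity)).ne' hne
  have hcount := (Measure.countable_meas_level_set_pos (μ := symLebesgue p)
    (Measurable.ite measurableSet_posDef (measurable_trace_mul_inv G) measurable_const)).mono hall
  have := hcount.measure_zero volume
  simp at this

end SymLebesgue

/-! ### Integrability of the kernels and the shift estimate. -/

section Kernel

variable {p : ℕ} {l : ℝ} {P G S : Matrix (Fin p) (Fin p) ℝ}

theorem mgigKernel_of_posDef (hS : S.PosDef) :
    mgigKernel l P G S = S.det ^ l * Real.exp (-(P * S).trace / 2) *
      Real.exp (-(G * S⁻¹).trace / 2) := by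
  rw [mgigKernel, if_pos hS, mul_assoc, ← Real.exp_add, Matrix.trace_add]
  congr 2
  ring

theorem mgigKernel_of_not_posDef (hS : ¬ S.PosDef) : mgigKernel l P G S = 0 := if_neg hS

theorem mgigKernel_zero_of_posDef (hS : S.PosDef) :
    mgigKernel l P 0 S = S.det ^ l * Real.exp (-(P * S).trace / 2) := by
  simp [mgigKernel_of_posDef hS]

theorem mgigKernel_eq_mul_exp :
    mgigKernel l P G S = mgigKernel l P 0 S * Real.exp (-(G * S⁻¹).trace / 2) := by
  by_cases hS : S.PosDef
  · rw [mgigKernel_of_posDef hS, mgigKernel_zero_of_posDef hS]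
  · simp [mgigKernel_of_not_posDef hS]

theorem mgigKernel_pos (hS : S.PosDef) : 0 < mgigKernel l P G S := by
  rw [mgigKernel_of_posDef hS]
  have := Real.rpow_pos_of_pos hS.det_pos l
  positivity

theorem mgigKernel_nonneg : 0 ≤ mgigKernel l P G S := by
  by_cases hS : S.PosDef
  · exact (mgigKernel_pos hS).le
  · exact (mgigKernel_of_not_posDef hS).ge

theorem mgigKernel_le_mgigKernel_zero (hG : G.PosSemidef) :
    mgigKernel l P G S ≤ mgigKernel l P 0 S := by
  by_cases hS : S.PosDef
  · rw [mgigKernel_eq_mul_exp]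
    refine mul_le_of_le_one_right mgigKernel_nonneg (Real.exp_le_one_iff.2 ?_)
    linarith [hG.trace_mul_nonneg hS.inv.posSemidef]
  · rw [mgigKernel_of_not_posDef hS, mgigKernel_of_not_posDef hS]

/-- This places the proposal in the target family as the member with `Γ = 0`, so one set of lemmas
serves both laws. -/
theorem wishartKernel_eq_mgigKernel_zero (hP : P.PosDef) :
    wishartKernel (2 * l + ((p : ℝ) + 1)) P⁻¹ S = mgigKernel l P 0 S := by
  by_cases hS : S.PosDef
  · rw [mgigKernel_zero_of_posDef hS, wishartKernel, if_pos hS,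
      Matrix.nonsing_inv_nonsing_inv _ hP.det_pos.ne'.isUnit, Matrix.trace_mul_comm]
    congr 2
    ring
  · rw [mgigKernel_of_not_posDef hS, wishartKernel, if_neg hS]

theorem proposalDensity_eq_mgigDensity_zero (hP : P.PosDef) :
    proposalDensity l P = mgigDensity l P 0 := by
  funext S
  simp only [proposalDensity, wishartDensity, mgigDensity, wishartKernel_eq_mgigKernel_zero hP]

theorem proposal_eq_mgig_zero (hP : P.PosDef) : proposal l P = mgig l P 0 := by
  simp only [proposal, wishart, mgig, ← proposalDensity_eq_mgigDensity_zero hP, proposalDensity]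

/-- A polynomial times a decaying exponential is dominated by any inverse power. -/
theorem exists_rpow_mul_exp_neg_le (a r : ℝ) {c : ℝ} (hc : 0 < c) :
    ∃ C : ℝ, 0 ≤ C ∧ ∀ t : ℝ, 0 ≤ t →
      (1 + t) ^ a * Real.exp (-(c * t)) ≤ C * (1 + t) ^ (-r) := by
  obtain ⟨n, hn⟩ := exists_nat_ge (a + r)
  refine ⟨Real.exp c * n.factorial / c ^ n, by positivity, fun t ht => ?_⟩
  have hu : 0 < 1 + t := by linarith
  have h1 : (1 + t) ^ (a + r) ≤ (1 + t) ^ n := by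
    rw [← Real.rpow_natCast]
    exact Real.rpow_le_rpow_of_exponent_le (by linarith) hn
  -- One term of the exponential series at `c * (1 + t)`; the extra `exp c` in the constant pays for
  -- replacing `t` by `1 + t`.
  have h2 := Real.pow_div_factorial_le_exp (c * (1 + t)) (by positivity) n
  rw [div_le_iff₀ (by positivity), mul_pow] at h2
  have h3 : (1 + t) ^ (a + r) * Real.exp (-(c * t)) ≤ Real.exp c * n.factorial / c ^ n := by
    rw [le_div_iff₀ (by positivity)]
    calc (1 + t) ^ (a + r) * Real.exp (-(c * t)) * c ^ n
        ≤ (1 + t) ^ n * Real.exp (-(c * t)) * c ^ n := by gcongr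
      _ = (c ^ n * (1 + t) ^ n) * Real.exp (-(c * t)) := by ring
      _ ≤ (Real.exp (c * (1 + t)) * n.factorial) * Real.exp (-(c * t)) := by gcongr
      _ = Real.exp c * n.factorial := by
        rw [mul_right_comm, ← Real.exp_add]
        ring_nf
  calc (1 + t) ^ a * Real.exp (-(c * t))
      = (1 + t) ^ (a + r) * Real.exp (-(c * t)) * (1 + t) ^ (-r) := by
        rw [mul_right_comm, ← Real.rpow_add hu]
        ring_nf
    _ ≤ _ := by gcongr

/-- On the cone the determinant is at most `p! (1 + tr S)^p`, while the exponential decays in `tr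
S`, which dominates the sup norm of the coordinates. -/
theorem mgigKernel_zero_le (hl : 0 ≤ l) (hP : P.PosDef) (r : ℝ) (hr : 0 ≤ r) :
    ∃ C : ℝ, ∀ x : UpperIndex p → ℝ,
      mgigKernel l P 0 (symMatrix x) ≤ C * (1 + ‖x‖) ^ (-r) := by
  obtain ⟨c, hc, hcP⟩ := hP.exists_mul_trace_le
  obtain ⟨C, hC, hbound⟩ := exists_rpow_mul_exp_neg_le (p * l) r (half_pos hc)
  refine ⟨(p.factorial : ℝ) ^ l * C, fun x => ?_⟩
  by_cases hS : (symMatrix x).PosDef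
  · set S := symMatrix x with hSx
    have ht : 0 ≤ S.trace := hS.posSemidef.trace_nonneg
    have hdet : S.det ≤ p.factorial * (1 + S.trace) ^ p := by
      have := Matrix.det_le (A := S) (abv := AbsoluteValue.abs) (x := 1 + S.trace) fun i j =>
        (hS.posSemidef.abs_apply_le_trace i j).trans (by linarith)
      simpa using (le_abs_self _).trans this
    have hx : ‖x‖ ≤ S.trace := by
      refine (pi_norm_le_iff_of_nonneg ht).2 fun q => ?_
      have hq : x q = S q.1.1 q.1.2 := by
        simp [hSx, symMatrix, q.2]
      rw [hq]
      exact hS.posSemidef.abs_apply_le_trace _ _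
    have hpow : S.det ^ l ≤ (p.factorial : ℝ) ^ l * (1 + S.trace) ^ (p * l) := by
      refine (Real.rpow_le_rpow hS.det_pos.le hdet hl).trans_eq ?_
      rw [Real.mul_rpow (by positivity) (by positivity), ← Real.rpow_natCast,
        ← Real.rpow_mul (by positivity)]
    have hexp : Real.exp (-(P * S).trace / 2) ≤ Real.exp (-(c / 2 * S.trace)) :=
      Real.exp_le_exp.2 (by linarith [hcP S hS.posSemidef])
    rw [mgigKernel_zero_of_posDef hS]
    calc S.det ^ l * Real.exp (-(P * S).trace / 2)
        ≤ ((p.factorial : ℝ) ^ l * (1 + S.trace) ^ (p * l)) *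
            Real.exp (-(c / 2 * S.trace)) := by gcongr
      _ = (p.factorial : ℝ) ^ l *
            ((1 + S.trace) ^ (p * l) * Real.exp (-(c / 2 * S.trace))) := mul_assoc _ _ _
      _ ≤ (p.factorial : ℝ) ^ l * (C * (1 + S.trace) ^ (-r)) :=
        mul_le_mul_of_nonneg_left (hbound _ ht) (by positivity)
      _ ≤ (p.factorial : ℝ) ^ l * (C * (1 + ‖x‖) ^ (-r)) := by
        have := Real.rpow_le_rpow_of_nonpos (z := -r) (x := 1 + ‖x‖) (y := 1 + S.trace)
          (by positivity) (by linarith) (by linarith)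
        gcongr
      _ = _ := (mul_assoc _ _ _).symm
  · rw [mgigKernel_of_not_posDef hS]
    positivity

theorem integrable_mgigKernel (hl : 0 ≤ l) (hP : P.PosDef) (hG : G.PosSemidef) :
    Integrable (mgigKernel l P G) (symLebesgue p) := by
  rw [symLebesgue, integrable_map_measure (measurable_mgigKernel l P G).aestronglyMeasurable
    measurable_symMatrix.aemeasurable]
  obtain ⟨C, hC⟩ := mgigKernel_zero_le hl hP
    -- Any decay exponent above the dimension makes the bound integrable.
    ((Module.finrank ℝ (UpperIndex p → ℝ) : ℝ) + 1) (by positivity)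
  refine ((integrable_one_add_norm (lt_add_one _)).const_mul C).mono'
    ((measurable_mgigKernel l P G).comp measurable_symMatrix).aestronglyMeasurable
    (Eventually.of_forall fun x => ?_)
  rw [Function.comp_apply, Real.norm_of_nonneg mgigKernel_nonneg]
  exact (mgigKernel_le_mgigKernel_zero hG).trans (hC x)

theorem integral_mgigKernel_pos (hl : 0 ≤ l) (hP : P.PosDef) (hG : G.PosSemidef) :
    0 < ∫ S, mgigKernel l P G S ∂(symLebesgue p) := by
  rw [integral_pos_iff_support_of_nonneg (fun _ => mgigKernel_nonneg)
    (integrable_mgigKernel hl hP hG)]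
  refine (pos_iff_ne_zero.2 symLebesgue_posDef_ne_zero).trans_le (measure_mono fun S hS => ?_)
  exact (mgigKernel_pos hS).ne'

/-- Pointwise comparison behind the concentration of `tr(G S⁻¹)`: shifting `S` by `G` multiplies
the determinant by at least `1 + tr(G S⁻¹)`. -/
theorem mgigKernel_shift_le (hl : 1 ≤ l) (hG : G.PosSemidef) :
    (1 + 1 / (2 * l)) * mgigKernel l P 0 S -
      Real.exp ((P * G).trace / 2) / (2 * l) * mgigKernel l P 0 (S + G) ≤
        mgigKernel l P G S := by
  have hl0 : 0 < l := by linarith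
  by_cases hS : S.PosDef
  · have hSG : (S + G).PosDef := hS.add_posSemidef hG
    rw [mgigKernel_eq_mul_exp (G := G), mgigKernel_zero_of_posDef hS,
      mgigKernel_zero_of_posDef hSG]
    have hY : 0 ≤ (G * S⁻¹).trace := hG.trace_mul_nonneg hS.inv.posSemidef
    set Y := (G * S⁻¹).trace
    have hD : S.det ^ l * (1 + l * Y) ≤ (S + G).det ^ l := by
      calc S.det ^ l * (1 + l * Y) ≤ S.det ^ l * (1 + Y) ^ l := by
            have := one_add_mul_self_le_rpow_one_add (s := Y) (by linarith) hl
            have := Real.rpow_nonneg hS.det_pos.le l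
            gcongr
        _ = (S.det * (1 + Y)) ^ l :=
            (Real.mul_rpow hS.det_pos.le (by linarith)).symm
        _ ≤ (S + G).det ^ l :=
            Real.rpow_le_rpow (mul_nonneg hS.det_pos.le (by linarith))
              (hS.det_mul_one_add_trace_le hG) hl0.le
    -- The factor `exp(tr(P G)/2)` undoes the effect of the shift on the exponential.
    have hE : Real.exp ((P * G).trace / 2) * Real.exp (-(P * (S + G)).trace / 2) =
        Real.exp (-(P * S).trace / 2) := by
      rw [← Real.exp_add, Matrix.mul_add, Matrix.trace_add]
      ring_nf
    have hY2 : 1 - Y / 2 ≤ Real.exp (-Y / 2) := by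
      linarith [Real.add_one_le_exp (-Y / 2)]
    have hDE : 0 ≤ S.det ^ l * Real.exp (-(P * S).trace / 2) :=
      mul_nonneg (Real.rpow_nonneg hS.det_pos.le l) (Real.exp_pos _).le
    have h1 : Real.exp ((P * G).trace / 2) / (2 * l) *
        ((S + G).det ^ l * Real.exp (-(P * (S + G)).trace / 2)) =
          (S + G).det ^ l * Real.exp (-(P * S).trace / 2) / (2 * l) := by
      rw [← hE]
      ring
    have h2 : S.det ^ l * (1 + l * Y) * Real.exp (-(P * S).trace / 2) / (2 * l) ≤
        (S + G).det ^ l * Real.exp (-(P * S).trace / 2) / (2 * l) := by gcongr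
    rw [h1]
    -- The weights `1 + 1/(2l)` and `1/(2l)` are those for which subtracting the Bernoulli bound
    -- leaves exactly `1 - Y/2`.
    calc _ ≤ (1 + 1 / (2 * l)) * (S.det ^ l * Real.exp (-(P * S).trace / 2)) -
            S.det ^ l * (1 + l * Y) * Real.exp (-(P * S).trace / 2) / (2 * l) := by linarith
      _ = S.det ^ l * Real.exp (-(P * S).trace / 2) * (1 - Y / 2) := by
          field_simp
          ring
      _ ≤ _ := mul_le_mul_of_nonneg_left hY2 hDE
  -- Here `S + G` may still lie in the cone; its term enters with a negative sign, so this is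
  -- harmless.
  · rw [mgigKernel_of_not_posDef hS, mgigKernel_of_not_posDef hS, mul_zero, zero_sub,
      neg_nonpos]
    exact mul_nonneg (by positivity) mgigKernel_nonneg

theorem integral_mgigKernel_zero_mul_le (hl : 1 ≤ l) (hP : P.PosDef) (hG : G.PosSemidef) :
    (1 + (1 - Real.exp ((P * G).trace / 2)) / (2 * l)) *
      ∫ S, mgigKernel l P 0 S ∂(symLebesgue p) ≤ ∫ S, mgigKernel l P G S ∂(symLebesgue p) := by
  have hl0 : 0 ≤ l := by linarith
  have hi := integrable_mgigKernel hl0 hP (Matrix.PosSemidef.zero (n := Fin p) (R := ℝ))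
  have hmp := measurePreserving_add_symLebesgue hG.1
  have hi' : Integrable (fun S => mgigKernel l P 0 (S + G)) (symLebesgue p) :=
    hmp.integrable_comp_of_integrable hi
  have hshift : ∫ S, mgigKernel l P 0 (S + G) ∂(symLebesgue p) =
      ∫ S, mgigKernel l P 0 S ∂(symLebesgue p) := by
    conv_rhs => rw [← hmp.map_eq]
    exact (integral_map hmp.measurable.aemeasurable
      (measurable_mgigKernel l P 0).aestronglyMeasurable).symm
  have h := integral_mono ((hi.const_mul _).sub (hi'.const_mul _))
    (integrable_mgigKernel hl0 hP hG) fun S => mgigKernel_shift_le (P := P) (S := S) hl hG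
  rw [integral_sub' (hi.const_mul _) (hi'.const_mul _), integral_const_mul, integral_const_mul,
    hshift] at h
  refine le_trans (le_of_eq ?_) h
  ring

end Kernel

/-! ### Comparing independent draws from two laws. -/

section Comparison

variable {α : Type*} [MeasurableSpace α] {μ ν : Measure α} [IsProbabilityMeasure μ]
  [IsProbabilityMeasure ν] {Y : α → ℝ}

/-- The event and its swap have equal probability, cover everything, and overlap only in ties, which
are null by Fubini. -/
theorem prod_self_real_le_eq_half (hY : Measurable Y) (hν : ∀ c, ν {a | Y a = c} = 0) :
    (ν.prod ν).real {z | Y z.2 ≤ Y z.1} = 1 / 2 := by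
  have hE : MeasurableSet {z : α × α | Y z.2 ≤ Y z.1} :=
    measurableSet_le (hY.comp measurable_snd) (hY.comp measurable_fst)
  have hswap : (ν.prod ν).real {z | Y z.1 ≤ Y z.2} = (ν.prod ν).real {z | Y z.2 ≤ Y z.1} := by
    have h := Measure.measurePreserving_swap (μ := ν) (ν := ν)
    exact h.measureReal_preimage hE.nullMeasurableSet
  have htie : (ν.prod ν).real ({z | Y z.1 ≤ Y z.2} ∩ {z | Y z.2 ≤ Y z.1}) = 0 := by
    rw [measureReal_eq_zero_iff]
    have hm : MeasurableSet ({z : α × α | Y z.1 ≤ Y z.2} ∩ {z | Y z.2 ≤ Y z.1}) :=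
      (measurableSet_le (hY.comp measurable_fst) (hY.comp measurable_snd)).inter hE
    rw [Measure.measure_prod_null hm]
    refine Eventually.of_forall fun a => measure_mono_null (fun b hb => ?_) (hν (Y a))
    exact le_antisymm hb.2 hb.1
  have hunion : ({z : α × α | Y z.1 ≤ Y z.2} ∪ {z | Y z.2 ≤ Y z.1}) = Set.univ :=
    Set.eq_univ_of_forall fun z => le_total (Y z.1) (Y z.2)
  have h := measureReal_union_add_inter (μ := ν.prod ν) (s := {z : α × α | Y z.1 ≤ Y z.2}) hE
  rw [hunion, htie, hswap, probReal_univ] at h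
  linarith

/-- If `μ ≤ r ν`, then independent draws from `μ` and `ν` are compared almost as symmetrically as
two independent draws from `ν`. -/
theorem abs_two_mul_prod_real_le_sub_one (hY : Measurable Y) (hν : ∀ c, ν {a | Y a = c} = 0)
    {r : ℝ} (hr : 0 ≤ r) (hμ : μ ≤ ENNReal.ofReal r • ν) :
    |2 * (μ.prod ν).real {z | Y z.2 ≤ Y z.1} - 1| ≤ r - 1 := by
  have hE : MeasurableSet {z : α × α | Y z.2 ≤ Y z.1} :=
    measurableSet_le (hY.comp measurable_snd) (hY.comp measurable_fst)
  have hle : ∀ s : Set (α × α), (μ.prod ν).real s ≤ r * (ν.prod ν).real s := by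
    intro s
    have h : μ.prod ν ≤ ENNReal.ofReal r • ν.prod ν := by
      rw [← Measure.prod_smul_left]
      exact Measure.prod_mono hμ le_rfl
    have h2 := ENNReal.toReal_mono
      (ENNReal.mul_ne_top ENNReal.ofReal_ne_top (measure_ne_top _ _)) (h s)
    simpa [Measure.real, ENNReal.toReal_mul, hr] using h2
  have hhalf := prod_self_real_le_eq_half hY hν
  have h1 := hle {z | Y z.2 ≤ Y z.1}
  -- Domination only gives upper bounds; applied to the complement it supplies the lower one.
  have h2 := hle {z | Y z.2 ≤ Y z.1}ᶜ
  rw [probReal_compl_eq_one_sub hE, probReal_compl_eq_one_sub hE] at h2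
  rw [hhalf] at h1 h2
  rw [abs_le]
  constructor <;> linarith

end Comparison

/-! ### The target and proposal laws and their acceptance rates. -/

section Mgig

variable {p : ℕ} {l : ℝ} {P G : Matrix (Fin p) (Fin p) ℝ}

theorem measurable_mgigDensity : Measurable (mgigDensity l P G) :=
  (measurable_mgigKernel l P G).div_const _

theorem mgigDensity_nonneg (S : Matrix (Fin p) (Fin p) ℝ) : 0 ≤ mgigDensity l P G S :=
  div_nonneg mgigKernel_nonneg (integral_nonneg fun _ => mgigKernel_nonneg)

theorem isProbabilityMeasure_mgig (hl : 0 ≤ l) (hP : P.PosDef) (hG : G.PosSemidef) :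
    IsProbabilityMeasure (mgig l P G) := by
  refine ⟨?_⟩
  have hZ := integral_mgigKernel_pos hl hP hG
  rw [mgig, withDensity_apply _ MeasurableSet.univ, Measure.restrict_univ,
    ← ofReal_integral_eq_lintegral_ofReal (f := mgigDensity l P G)
      ((integrable_mgigKernel hl hP hG).div_const _)
      (Eventually.of_forall mgigDensity_nonneg)]
  simp only [mgigDensity]
  rw [integral_div, div_self hZ.ne', ENNReal.ofReal_one]

theorem ae_posDef_mgig : ∀ᵐ S ∂(mgig l P G), S.PosDef := by
  rw [mgig, ae_withDensity_iff measurable_mgigDensity.ennreal_ofReal]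
  refine Eventually.of_forall fun S hS => ?_
  by_contra h
  simp [mgigDensity, mgigKernel_of_not_posDef h] at hS

theorem mgig_level_set_eq_zero (hp : 1 ≤ p) {A : Matrix (Fin p) (Fin p) ℝ} (hA : A.PosDef)
    (c : ℝ) : mgig l P G {S | (A * S⁻¹).trace = c} = 0 := by
  have h1 : mgig l P G {S | S.PosDef ∧ (A * S⁻¹).trace = c} = 0 :=
    withDensity_absolutelyContinuous _ _ (symLebesgue_level_set_eq_zero hp hA c)
  refine measure_mono_null (fun S hS => ?_) (measure_union_null h1 (ae_iff.1 ae_posDef_mgig))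
  by_cases h : S.PosDef
  · exact Or.inl ⟨h, hS⟩
  · exact Or.inr h

/-- The ratio of the normalizing constants of the target and of the proposal, which is the mean of
`exp(-tr(G S⁻¹) / 2)` under the proposal. -/
noncomputable def normalizationRatio (l : ℝ) (P G : Matrix (Fin p) (Fin p) ℝ) : ℝ :=
  (∫ S, mgigKernel l P G S ∂(symLebesgue p)) / ∫ S, mgigKernel l P 0 S ∂(symLebesgue p)

theorem normalizationRatio_pos (hl : 0 ≤ l) (hP : P.PosDef) (hG : G.PosSemidef) :
    0 < normalizationRatio l P G :=
  div_pos (integral_mgigKernel_pos hl hP hG) (integral_mgigKernel_pos hl hP .zero)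

theorem tendsto_normalizationRatio (hP : P.PosDef) (hG : G.PosSemidef) :
    Tendsto (fun l => normalizationRatio l P G) atTop (𝓝 1) := by
  have hlow : Tendsto (fun l : ℝ => 1 + (1 - Real.exp ((P * G).trace / 2)) / (2 * l)) atTop
      (𝓝 1) := by
    simpa using tendsto_const_nhds.add
      ((tendsto_const_nhds (x := 1 - Real.exp ((P * G).trace / 2))).div_atTop
        (tendsto_id.const_mul_atTop (zero_lt_two' ℝ)))
  refine tendsto_of_tendsto_of_tendsto_of_le_of_le' hlow tendsto_const_nhds ?_ ?_
  · filter_upwards [eventually_ge_atTop 1] with l hl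
    rw [normalizationRatio, le_div_iff₀ (integral_mgigKernel_pos (by linarith) hP .zero)]
    exact integral_mgigKernel_zero_mul_le hl hP hG
  · filter_upwards [eventually_ge_atTop 0] with l hl
    rw [normalizationRatio, div_le_one (integral_mgigKernel_pos hl hP .zero)]
    exact integral_mono (integrable_mgigKernel hl hP hG) (integrable_mgigKernel hl hP .zero)
      fun S => mgigKernel_le_mgigKernel_zero hG

theorem mgigDensity_eq (hl : 0 ≤ l) (hP : P.PosDef) (hG : G.PosSemidef)
    (S : Matrix (Fin p) (Fin p) ℝ) :
    mgigDensity l P G S = (normalizationRatio l P G)⁻¹ * mgigDensity l P 0 S *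
      Real.exp (-(G * S⁻¹).trace / 2) := by
  have h0 := integral_mgigKernel_pos hl hP (.zero (n := Fin p) (R := ℝ))
  have h1 := integral_mgigKernel_pos hl hP hG
  rw [mgigDensity, mgigDensity, normalizationRatio, mgigKernel_eq_mul_exp (G := G) (S := S)]
  field_simp

theorem mgig_le_smul_mgig_zero (hl : 0 ≤ l) (hP : P.PosDef) (hG : G.PosSemidef) :
    mgig l P G ≤ ENNReal.ofReal (normalizationRatio l P G)⁻¹ • mgig l P 0 := by
  rw [mgig, mgig, ← withDensity_smul _ measurable_mgigDensity.ennreal_ofReal]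
  refine withDensity_mono (Eventually.of_forall fun S => ?_)
  rw [Pi.smul_apply, smul_eq_mul,
    ← ENNReal.ofReal_mul (inv_nonneg.2 (normalizationRatio_pos hl hP hG).le)]
  refine ENNReal.ofReal_le_ofReal ?_
  have h0 := integral_mgigKernel_pos hl hP (.zero (n := Fin p) (R := ℝ))
  have h1 := integral_mgigKernel_pos hl hP hG
  have hle : mgigKernel l P G S ≤ mgigKernel l P 0 S := mgigKernel_le_mgigKernel_zero hG
  calc mgigDensity l P G S ≤ mgigKernel l P 0 S / ∫ T, mgigKernel l P G T ∂(symLebesgue p) := by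
        rw [mgigDensity]
        gcongr
    _ = _ := by
        rw [mgigDensity, normalizationRatio]
        field_simp

theorem integral_exp_trace_mgig_zero :
    ∫ S, Real.exp (-(G * S⁻¹).trace / 2) ∂(mgig l P 0) = normalizationRatio l P G := by
  rw [mgig, integral_withDensity_eq_integral_toReal_smul
    measurable_mgigDensity.ennreal_ofReal (Eventually.of_forall fun _ => ENNReal.ofReal_lt_top),
    normalizationRatio, ← integral_div]
  refine integral_congr_ae (Eventually.of_forall fun S => ?_)
  simp only [smul_eq_mul, ENNReal.toReal_ofReal (mgigDensity_nonneg S)]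
  rw [mgigDensity, mgigKernel_eq_mul_exp (G := G), div_mul_eq_mul_div]

/-- Normalizing constants cancel, so the Hastings ratio is `exp((Y(S) - Y(T))/2)`. Dropping `Y(S) ≥
0` leaves a bound in the proposed state alone, whose mean is `normalizationRatio`. -/
theorem exp_trace_le_acceptanceProb (hl : 0 ≤ l) (hP : P.PosDef) (hG : G.PosSemidef)
    {S T : Matrix (Fin p) (Fin p) ℝ} (hS : S.PosDef) (hT : T.PosDef) :
    Real.exp (-(G * T⁻¹).trace / 2) ≤ acceptanceProb l P G S T := by
  have h0 := integral_mgigKernel_pos hl hP (.zero (n := Fin p) (R := ℝ))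
  have hr := normalizationRatio_pos hl hP hG
  have hqS : 0 < mgigDensity l P 0 S := div_pos (mgigKernel_pos hS) h0
  have hqT : 0 < mgigDensity l P 0 T := div_pos (mgigKernel_pos hT) h0
  have hYS : 0 ≤ (G * S⁻¹).trace := hG.trace_mul_nonneg hS.inv.posSemidef
  have hYT : 0 ≤ (G * T⁻¹).trace := hG.trace_mul_nonneg hT.inv.posSemidef
  rw [acceptanceProb, proposalDensity_eq_mgigDensity_zero hP]
  refine le_min (Real.exp_le_one_iff.2 (by linarith)) ?_
  have hratio : mgigDensity l P G T * mgigDensity l P 0 S /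
      (mgigDensity l P G S * mgigDensity l P 0 T) =
        Real.exp (-(G * T⁻¹).trace / 2) / Real.exp (-(G * S⁻¹).trace / 2) := by
    rw [mgigDensity_eq hl hP hG S, mgigDensity_eq hl hP hG T]
    field_simp
  rw [hratio, ← Real.exp_sub, Real.exp_le_exp]
  linarith

theorem normalizationRatio_le_expectedAcceptanceProb (hl : 0 ≤ l) (hP : P.PosDef)
    (hG : G.PosSemidef) :
    normalizationRatio l P G ≤ expectedAcceptanceProb l P G ∧
      expectedAcceptanceProb l P G ≤ 1 := by
  have := isProbabilityMeasure_mgig hl hP hG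
  have := isProbabilityMeasure_mgig hl hP (.zero (n := Fin p) (R := ℝ))
  have hnonneg : ∀ S T : Matrix (Fin p) (Fin p) ℝ, 0 ≤ acceptanceProb l P G S T := by
    intro S T
    rw [acceptanceProb, proposalDensity_eq_mgigDensity_zero hP]
    exact le_min zero_le_one (div_nonneg (mul_nonneg (mgigDensity_nonneg _) (mgigDensity_nonneg _))
      (mul_nonneg (mgigDensity_nonneg _) (mgigDensity_nonneg _)))
  have hle : ∀ S T : Matrix (Fin p) (Fin p) ℝ, acceptanceProb l P G S T ≤ 1 :=
    fun _ _ => min_le_left _ _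
  have hmeas : Measurable fun z : Matrix (Fin p) (Fin p) ℝ × Matrix (Fin p) (Fin p) ℝ =>
      acceptanceProb l P G z.1 z.2 := by
    simp only [acceptanceProb, proposalDensity_eq_mgigDensity_zero hP]
    exact measurable_const.min
      (((measurable_mgigDensity.comp measurable_snd).mul
        (measurable_mgigDensity.comp measurable_fst)).div
          ((measurable_mgigDensity.comp measurable_fst).mul
            (measurable_mgigDensity.comp measurable_snd)))
  rw [expectedAcceptanceProb, oldNewLaw, proposal_eq_mgig_zero hP]
  have hint : Integrable (fun z : Matrix (Fin p) (Fin p) ℝ × Matrix (Fin p) (Fin p) ℝ =>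
      acceptanceProb l P G z.1 z.2) ((mgig l P G).prod (mgig l P 0)) :=
    (integrable_const (1 : ℝ)).mono' hmeas.aestronglyMeasurable
      (Eventually.of_forall fun z => by
        rw [Real.norm_of_nonneg (hnonneg _ _)]
        exact hle _ _)
  constructor
  · have hsnd : ∫ z, Real.exp (-(G * z.2⁻¹).trace / 2) ∂((mgig l P G).prod (mgig l P 0)) =
        normalizationRatio l P G := by
      rw [integral_fun_snd
        (fun S : Matrix (Fin p) (Fin p) ℝ => Real.exp (-(G * S⁻¹).trace / 2)), probReal_univ, one_smul,
        integral_exp_trace_mgig_zero]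
    rw [← hsnd]
    refine integral_mono_of_nonneg (Eventually.of_forall fun z => (Real.exp_pos _).le) hint ?_
    filter_upwards [
      Measure.quasiMeasurePreserving_fst.ae (ae_posDef_mgig (l := l) (P := P) (G := G)),
      Measure.quasiMeasurePreserving_snd.ae (ae_posDef_mgig (l := l) (P := P) (G := 0))]
      with z h1 h2
    exact exp_trace_le_acceptanceProb hl hP hG h1 h2
  · refine (integral_mono hint (integrable_const 1) fun z => hle _ _).trans_eq ?_
    simp

theorem abs_averageAcceptanceRate_sub_one_le (hp : 1 ≤ p) (hl : 0 ≤ l) (hP : P.PosDef)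
    (hG : G.PosDef) :
    |averageAcceptanceRate l P G - 1| ≤ (normalizationRatio l P G)⁻¹ - 1 := by
  have := isProbabilityMeasure_mgig hl hP hG.posSemidef
  have := isProbabilityMeasure_mgig hl hP (.zero (n := Fin p) (R := ℝ))
  rw [averageAcceptanceRate, oldNewLaw, proposal_eq_mgig_zero hP]
  exact abs_two_mul_prod_real_le_sub_one (measurable_trace_mul_inv G)
    (mgig_level_set_eq_zero hp hG)
    (inv_nonneg.2 (normalizationRatio_pos hl hP hG.posSemidef).le)
    (mgig_le_smul_mgig_zero hl hP hG.posSemidef)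

end Mgig

theorem mainTheorem3 (p : ℕ) (hp : 1 ≤ p) (Ψ Γ : Matrix (Fin p) (Fin p) ℝ)
    (hΨ : Ψ.PosDef) (hΓ : Γ.PosDef) :
    Tendsto (fun l : ℝ => averageAcceptanceRate l Ψ Γ) atTop (𝓝 1) ∧
      Tendsto (fun l : ℝ => expectedAcceptanceProb l Ψ Γ) atTop (𝓝 1) := by
  have hratio := tendsto_normalizationRatio hΨ hΓ.posSemidef
  constructor
  · rw [tendsto_iff_norm_sub_tendsto_zero]
    have hinv : Tendsto (fun l => (normalizationRatio l Ψ Γ)⁻¹ - 1) atTop (𝓝 0) := by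
      simpa using (hratio.inv₀ one_ne_zero).sub_const 1
    refine tendsto_of_tendsto_of_tendsto_of_le_of_le' tendsto_const_nhds hinv
      (Eventually.of_forall fun _ => norm_nonneg _) ?_
    filter_upwards [eventually_ge_atTop 0] with l hl
    exact abs_averageAcceptanceRate_sub_one_le hp hl hΨ hΓ
  · refine tendsto_of_tendsto_of_tendsto_of_le_of_le' hratio tendsto_const_nhds ?_ ?_
    · filter_upwards [eventually_ge_atTop 0] with l hl
      exact (normalizationRatio_le_expectedAcceptanceProb hl hΨ hΓ.posSemidef).1
    · filter_upwards [eventually_ge_atTop 0] with l hl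
      exact (normalizationRatio_le_expectedAcceptanceProb hl hΨ hΓ.posSemidef).2
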